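/- Let $\mathcal P$ be a principal ideal domain. A (finite, loopless) signed multidigraph $G$ has, for each ordered pair $(u,w)$ of distinct vertices, a number $m_{uw}\ge 0$ of arcs from $u$ to $w$, with sign $\sigma(uw)\in\{1,-1\}$. Its generalized Laplacian matrix $L(G,X)$ over $\mathcal P[x_u : u\in V(G)]$ has diagonal entries $L(G,X)_{uu}=x_u$ and off-diagonal entries $L(G,X)_{uw}=-\sigma(uw)\,m_{uw}1_{\mathcal P}$. The $j$-th critical ideal $I_j(G,X)$ is the ideal of $\mathcal P[x_u : u\in V(G)]$ generated by the $j\times j$ minors of $L(G,X)$ (so $I_0(G,X)=\langle 1\rangle$, and $I_j(G,X)=\langle 0\rangle$ for $j>|V(G)|$), and the algebraic co-rank $\gamma_{\mathcal P}(G)$ is the largest $j$ with $I_j(G,X)=\langle 1\rangle$. For $v\in V(G)$ and $K\ge 0$ let $r^K(G,v)$ be obtained from $G$ by adding $K$ new vertices $v^1,\dots,v^K$, each having the same arcs (with the same multiplicities and signs) to and from every vertex $u\ne v$ of $G$ as $v=v^0$ has, together with one arc of sign $+1$ from $v^a$ to $v^b$ for all $0\le a\neq b\le K$; write $r(G,v)=r^1(G,v)$.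 For $l\ge 0$ put \[ \widetilde P^{K}_{l}(v)=\Big\{\prod_{c\in C}(x_{v^c}+1) : C\subseteq\{0,1,\dots,K\},\ |C|=l\Big\}, \] so that $\widetilde P^{K}_0(v)=\{1\}$. Let $I_j(G,X)|_{x_v=-1}$ denote the image of $I_j(G,X)$ under the substitution $x_v=-1$. **Theorem.** Let $G$ be a signed multidigraph and $v\in V(G)$. Put $\gamma_r=\gamma_{\mathcal P}(r(G,v))$ and $\gamma_v=\gamma_{\mathcal P}(G-v)$, and let $\lambda=0$ if $\gamma_v=\gamma_r$ and $\lambda=1$ otherwise. If $\gamma_{\mathcal P}(G)\ge 2$, then $0\le\gamma_r-\gamma_v\le 2$ and, for all $k\ge 1$ and $i\ge 0$, \[ I_{\gamma_r+k}\big(r^{k+\lambda+i}(G,v),X\big)=\Big\langle \bigcup_{l=0}^{k}\widetilde P^{\,k+\lambda+i}_{l}(v)\cdot I_{\gamma_r+k-l}(G,X)|_{x_v=-1}\Big\rangle \] as ideals of the polynomial ring over $\mathcal P$ in the variables of $r^{k+\lambda+i}(G,v)$. -/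

import Mathlib

open scoped Pointwise

/-- A (loopless) signed multidigraph on the vertex set `V`: `mult u w` is the number of arcs from
`u` to `w`, and `sign u w` is the sign of these arcs (irrelevant if there are none). -/
structure SignedMultidigraph (V : Type*) where
  mult : V → V → ℕ
  sign : V → V → ℤˣ
  mult_self : ∀ u, mult u u = 0

namespace SignedMultidigraph

/-- The graph `G - v`. -/
def deleteVertex {V : Type*} (G : SignedMultidigraph V) (v : V) :
    SignedMultidigraph {u : V // u ≠ v} where
  mult u w := G.mult u w
  sign u w := G.sign u w
  mult_self u := G.mult_self u

/-- The map sending every vertex of `r^K(G, v)` to the vertex of `G` of which it is a copy. -/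
def original {V : Type*} (v : V) (K : ℕ) : V ⊕ Fin K → V :=
  Sum.elim id (fun _ => v)

/-- The copies `v^0 = v, v^1, ..., v^K` of `v` in `r^K(G, v)`. -/
def copy {V : Type*} (v : V) (K : ℕ) (c : Fin (K + 1)) : V ⊕ Fin K :=
  Fin.cases (Sum.inl v) Sum.inr c

/-- The graph `r^K(G, v)` obtained by replicating `K` times the vertex `v`: the new vertices are
`Sum.inr c`, each one has the same arcs (with multiplicities and signs) to and from the vertices
other than `v` as `v` has, and there is one positive arc from every copy of `v` to every other copy.
The graph `r(G, v)` is the case `K = 1`. -/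
def replicate {V : Type*} [DecidableEq V] (G : SignedMultidigraph V) (v : V) (K : ℕ) :
    SignedMultidigraph (V ⊕ Fin K) where
  mult p q :=
    if p = q then 0
    else if original v K p = original v K q then 1
    else G.mult (original v K p) (original v K q)
  sign p q :=
    if original v K p = original v K q then 1
    else G.sign (original v K p) (original v K q)
  mult_self p := if_pos rfl

/-- The generalized Laplacian matrix `L(G, X)` over `P[X]`. -/
noncomputable def genLaplacian (P : Type*) [CommRing P] {V : Type*} [DecidableEq V]
    (G : SignedMultidigraph V) : Matrix V V (MvPolynomial V P) :=
  fun u w =>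
    if u = w then MvPolynomial.X u
    else MvPolynomial.C (-(((G.sign u w : ℤ) : P) * (G.mult u w : P)))

/-- The critical ideal `I_j(G, X)`, generated by the determinants of the `j × j` submatrices of
`L(G, X)`. It is the unit ideal for `j = 0` and the zero ideal for `j > |V|`. -/
noncomputable def criticalIdeal (P : Type*) [CommRing P] {V : Type*} [DecidableEq V]
    (G : SignedMultidigraph V) (j : ℕ) : Ideal (MvPolynomial V P) :=
  Ideal.span {d | ∃ f g : Fin j ↪ V, d = ((genLaplacian P G).submatrix f g).det}

/-- The algebraic co-rank `γ_P(G)`: the maximum `j` for which `I_j(G, X)` is trivial. -/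
noncomputable def coRank (P : Type*) [CommRing P] {V : Type*} [DecidableEq V]
    (G : SignedMultidigraph V) : ℕ :=
  sSup {j : ℕ | criticalIdeal P G j = ⊤}

/-- The evaluation `x_v = a`, the other variables being kept. -/
noncomputable def evalVar {P : Type*} [CommRing P] {V : Type*} [DecidableEq V] (v : V) (a : P) :
    MvPolynomial V P →ₐ[P] MvPolynomial V P :=
  MvPolynomial.aeval (Function.update MvPolynomial.X v (MvPolynomial.C a))

/-- The evaluated critical ideal `I_j(G, X)|_{x_v = -1}`, generated inside the polynomial ring of
`r^K(G, v)`. -/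
noncomputable def evalCriticalIdeal (P : Type*) [CommRing P] {V : Type*} [DecidableEq V]
    (G : SignedMultidigraph V) (v : V) (K j : ℕ) : Ideal (MvPolynomial (V ⊕ Fin K) P) :=
  ((criticalIdeal P G j).map (evalVar v (-1 : P))).map
    (MvPolynomial.rename (Sum.inl : V → V ⊕ Fin K) : _ →ₐ[P] _)

/-- The set of products of `l` of the factors `x_{v^c} + 1`, where `0 ≤ c ≤ K`. -/
def replicaProducts (P : Type*) [CommRing P] {V : Type*} (v : V) (K l : ℕ) :
    Set (MvPolynomial (V ⊕ Fin K) P) :=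
  {p | ∃ C : Finset (Fin (K + 1)), C.card = l ∧
    p = ∏ c ∈ C, (MvPolynomial.X (copy v K c) + 1)}

/-- The constant `λ(r, s)`. -/
def lam (r s : ℕ) : ℕ := if r = s then 0 else 1

end SignedMultidigraph

/-! Let `M` be the Laplacian of `G` at `x_v = -1`. Arcs between copies of `v` also contribute `-1`,
so the Laplacian of `r^K(G, v)` is `M` with row and column `v` duplicated, plus a diagonal matrix
with entries `y_c = x_{v^c} + 1` at the copies (`genLaplacian_replicate`). Minors of the duplicated
matrix are zero or, up to sign, minors of `M`.

Expanding a minor along the diagonal part gives products of some `y_c` times complementary minors of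
`M`. Products with more than `k` factors are harmless, because the `γ_r`-minors of `M` already
generate the unit ideal.

Conversely, rows of two copies differ only in the columns of these copies, so bordering a minor by
row and column `v^c` and subtracting the border by a spare row `v^d` multiplies it by `y_c`
(`prod_mul_det_submatrix_mem`). Lifting a minor of `M` that uses `v` in both row and column takes
two spare copies. These exist unless all but one of the copies occur in the product; then `γ_v =
γ_r`, and minors of `G - v`, which need only one spare copy, suffice. -/

open MvPolynomial

/-! ### Ideals of minors: deletion, diagonal perturbation, bordering -/

namespace Matrix

variable {R S m n m' n' ι : Type*} [CommRing R] [CommRing S]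

/-- The ideal generated by the `j × j` minors of a matrix. Repeated rows or columns are allowed, as
they contribute zero. -/
def minorIdeal (A : Matrix m n R) (j : ℕ) : Ideal R :=
  Ideal.span {d | ∃ (f : Fin j → m) (g : Fin j → n), d = (A.submatrix f g).det}

theorem det_submatrix_mem_minorIdeal (A : Matrix m n R) {j : ℕ} (f : Fin j → m) (g : Fin j → n) :
    (A.submatrix f g).det ∈ A.minorIdeal j :=
  Ideal.subset_span ⟨f, g, rfl⟩

theorem minorIdeal_le_iff {A : Matrix m n R} {j : ℕ} {I : Ideal R} :
    A.minorIdeal j ≤ I ↔ ∀ (f : Fin j → m) (g : Fin j → n), (A.submatrix f g).det ∈ I := by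
  rw [minorIdeal, Ideal.span_le]
  exact ⟨fun h f g => h ⟨f, g, rfl⟩, by rintro h _ ⟨f, g, rfl⟩; exact h f g⟩

theorem minorIdeal_submatrix_le (A : Matrix m n R) (r : m' → m) (s : n' → n) (j : ℕ) :
    (A.submatrix r s).minorIdeal j ≤ A.minorIdeal j :=
  minorIdeal_le_iff.2 fun f g => by
    rw [submatrix_submatrix]
    exact det_submatrix_mem_minorIdeal _ _ _

theorem minorIdeal_transpose (A : Matrix m n R) (j : ℕ) :
    Aᵀ.minorIdeal j = A.minorIdeal j := by
  apply le_antisymm <;> refine minorIdeal_le_iff.2 fun f g => ?_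
  · rw [← transpose_submatrix, det_transpose]
    exact det_submatrix_mem_minorIdeal _ _ _
  · rw [← det_transpose, transpose_submatrix]
    exact det_submatrix_mem_minorIdeal _ _ _

theorem map_minorIdeal (A : Matrix m n R) (φ : R →+* S) (j : ℕ) :
    (A.minorIdeal j).map φ = (A.map φ).minorIdeal j := by
  rw [minorIdeal, minorIdeal, Ideal.map_span]
  congr 1
  ext d
  constructor
  · rintro ⟨_, ⟨f, g, rfl⟩, rfl⟩
    exact ⟨f, g, by rw [RingHom.map_det]; rfl⟩
  · rintro ⟨f, g, rfl⟩
    exact ⟨_, ⟨f, g, rfl⟩, by rw [RingHom.map_det]; rfl⟩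

theorem minorIdeal_map_eq_top {A : Matrix m n R} (φ : R →+* S) {j : ℕ} (h : A.minorIdeal j = ⊤) :
    (A.map φ).minorIdeal j = ⊤ := by
  rw [← map_minorIdeal, h, Ideal.map_top]

theorem minorIdeal_eq_span_embedding (A : Matrix m n R) (j : ℕ) :
    A.minorIdeal j =
      Ideal.span {d | ∃ (f : Fin j ↪ m) (g : Fin j ↪ n), d = (A.submatrix f g).det} := by
  apply le_antisymm
  · refine minorIdeal_le_iff.2 fun f g => ?_
    by_cases hf : Function.Injective f
    · by_cases hg : Function.Injective g
      · exact Ideal.subset_span ⟨⟨f, hf⟩, ⟨g, hg⟩, rfl⟩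
      · obtain ⟨a, b, hab, hne⟩ := Function.not_injective_iff.1 hg
        rw [det_zero_of_column_eq hne (fun k => by simp [hab])]
        exact zero_mem _
    · obtain ⟨a, b, hab, hne⟩ := Function.not_injective_iff.1 hf
      rw [det_zero_of_row_eq hne (by ext k; simp [hab])]
      exact zero_mem _
  · rw [Ideal.span_le]
    rintro _ ⟨f, g, rfl⟩
    exact det_submatrix_mem_minorIdeal _ _ _

/-- Deleting one row lowers the size of the minors by at most one. -/
theorem minorIdeal_succ_le_delete_row (A : Matrix m n R) (v : m) (j : ℕ) :
    A.minorIdeal (j + 1) ≤ (A.submatrix (Subtype.val : {u // u ≠ v} → m) id).minorIdeal j := by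
  rw [minorIdeal_eq_span_embedding, Ideal.span_le]
  rintro _ ⟨f, g, rfl⟩
  -- Expand along the row `v` if it is selected, otherwise along any row.
  obtain ⟨i, hi⟩ : ∃ i : Fin (j + 1), ∀ a, f (i.succAbove a) ≠ v := by
    by_cases h : ∃ i, f i = v
    · obtain ⟨i, rfl⟩ := h
      exact ⟨i, fun a ha => Fin.succAbove_ne i a (f.injective ha)⟩
    · exact ⟨0, fun a ha => h ⟨_, ha⟩⟩
  rw [SetLike.mem_coe, det_succ_row _ i]
  refine Ideal.sum_mem _ fun k _ => Ideal.mul_mem_left _ _ ?_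
  exact det_submatrix_mem_minorIdeal (A.submatrix (Subtype.val : {u // u ≠ v} → m) id)
    (fun a => ⟨f (i.succAbove a), hi a⟩) (fun a => g (k.succAbove a))

theorem minorIdeal_succ_le_delete_col (A : Matrix m n R) (v : n) (j : ℕ) :
    A.minorIdeal (j + 1) ≤ (A.submatrix id (Subtype.val : {u // u ≠ v} → n)).minorIdeal j := by
  rw [← minorIdeal_transpose, ← minorIdeal_transpose (A.submatrix _ _), transpose_submatrix]
  exact minorIdeal_succ_le_delete_row _ _ _

theorem minorIdeal_add_two_le_delete (A : Matrix m m R) (v : m) (j : ℕ) :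
    A.minorIdeal (j + 2) ≤
      (A.submatrix (Subtype.val : {u // u ≠ v} → m) (Subtype.val : {u // u ≠ v} → m)).minorIdeal
        j :=
  (minorIdeal_succ_le_delete_row A v (j + 1)).trans (minorIdeal_succ_le_delete_col _ v j)

/-- Every minor of `A + ∑ c ∈ D, y c • E (e c) (e c)` is a combination of products of the `y c`
and minors of `A` of complementary size. -/
theorem det_submatrix_add_sum_single_mem [DecidableEq m] [DecidableEq ι] (A : Matrix m m R)
    (e : ι → m) (y : ι → R) (D : Finset ι) {j : ℕ} (f g : Fin j → m) :
    ((A + ∑ c ∈ D, single (e c) (e c) (y c)).submatrix f g).det ∈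
      Ideal.span {d | ∃ C ⊆ D, ∃ l, C.card + l = j ∧ ∃ b ∈ A.minorIdeal l,
        d = (∏ c ∈ C, y c) * b} := by
  induction D using Finset.induction_on generalizing j with
  | empty =>
    refine Ideal.subset_span ⟨∅, subset_rfl, j, by simp, _, det_submatrix_mem_minorIdeal A f g, ?_⟩
    simp
  | insert c D hc ih =>
    set B := A + ∑ c ∈ D, single (e c) (e c) (y c) with hB
    have hBc : A + ∑ c ∈ insert c D, single (e c) (e c) (y c) = B + single (e c) (e c) (y c) := by
      rw [Finset.sum_insert hc, hB]
      abel
    rw [hBc]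
    have same (i : ℕ) (f' g' : Fin i → m) (h : ∀ a, f' a ≠ e c) :
        (B + single (e c) (e c) (y c)).submatrix f' g' = B.submatrix f' g' := by
      ext a b
      simp [(h a).symm]
    have old : (B.submatrix f g).det ∈ Ideal.span {d | ∃ C ⊆ insert c D, ∃ l, C.card + l = j ∧
        ∃ b ∈ A.minorIdeal l, d = (∏ c ∈ C, y c) * b} := by
      refine Ideal.span_mono ?_ (ih f g)
      rintro d ⟨C, hC, h⟩
      exact ⟨C, hC.trans (Finset.subset_insert _ _), h⟩
    by_cases hf : Function.Injective f
    swap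
    · obtain ⟨a, b, hab, hne⟩ := Function.not_injective_iff.1 hf
      rw [det_zero_of_row_eq hne (by ext k; simp [hab])]
      exact zero_mem _
    by_cases h : ∃ i, f i = e c
    swap
    · rw [same _ f g (fun a ha => h ⟨a, ha⟩)]
      exact old
    obtain ⟨i, hi⟩ := h
    obtain _ | j := j
    · exact i.elim0
    -- Laplace expansion along the only row that the new diagonal entry changes.
    have key : ((B + single (e c) (e c) (y c)).submatrix f g).det = (B.submatrix f g).det +
        ∑ k : Fin (j + 1), (-1) ^ (i + k : ℕ) * (if e c = g k then 1 else 0) *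
          (y c * (B.submatrix (f ∘ i.succAbove) (g ∘ k.succAbove)).det) := by
      rw [det_succ_row _ i, det_succ_row (B.submatrix f g) i, ← Finset.sum_add_distrib]
      refine Finset.sum_congr rfl fun k _ => ?_
      rw [submatrix_submatrix, submatrix_submatrix, same _ (f ∘ i.succAbove) _ fun a ha =>
        Fin.succAbove_ne i a (hf (ha.trans hi.symm))]
      simp only [submatrix_apply, single_apply, hi, true_and, Matrix.add_apply]
      split_ifs <;> ring
    rw [key]
    refine Ideal.add_mem _ old (Ideal.sum_mem _ fun k _ => Ideal.mul_mem_left _ _ ?_)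
    have h2 := Ideal.mul_mem_mul (Ideal.mem_span_singleton_self (y c))
      (ih (f ∘ i.succAbove) (g ∘ k.succAbove))
    rw [Ideal.span_mul_span'] at h2
    refine Ideal.span_mono ?_ h2
    rintro _ ⟨_, rfl, _, ⟨C, hC, l, hl, b, hb, rfl⟩, rfl⟩
    have hcC : c ∉ C := fun h => hc (hC h)
    refine ⟨insert c C, Finset.insert_subset_insert _ hC, l, ?_, b, hb, ?_⟩
    · rw [Finset.card_insert_of_notMem hcC]
      omega
    · rw [Finset.prod_insert hcC]
      ring

/-- If the rows `e c` of `A` agree away from the diagonal and `A (e c) (e c)` exceeds the other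
entries by `y c`, then minors of `A` multiplied by the `y c` are combinations of larger minors. -/
theorem prod_mul_det_submatrix_mem [DecidableEq ι] (A : Matrix m m R)
    (e : ι → m) (y : ι → R) (he : Function.Injective e)
    (off : ∀ c d q, q ≠ e c → q ≠ e d → A (e c) q = A (e d) q)
    (diag : ∀ c d, c ≠ d → A (e c) (e c) = A (e d) (e c) + y c)
    (d : ι) (C : Finset ι) (hd : d ∉ C) {j : ℕ} (f g : Fin j → m)
    (hg : ∀ a, ∀ c ∈ C, g a ≠ e c) (hgd : ∀ a, g a ≠ e d) :
    (∏ c ∈ C, y c) * (A.submatrix f g).det ∈ A.minorIdeal (j + C.card) := by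
  induction C using Finset.induction_on generalizing j with
  | empty => simpa using det_submatrix_mem_minorIdeal A f g
  | insert c C hc ih =>
    have hdc : c ≠ d := fun h => hd (h ▸ Finset.mem_insert_self _ _)
    have hdC : d ∉ C := fun h => hd (Finset.mem_insert_of_mem h)
    -- Both bordered minors are expanded along the new row: the entries in the columns `g` agree and
    -- cancel, and column `e c` leaves `y c`. Both keep column `e d` unused, so the induction
    -- continues with the same `d`.
    have key : y c * (A.submatrix f g).det =
        (A.submatrix (Fin.cons (e c) f : Fin (j + 1) → m) (Fin.cons (e c) g)).det -
          (A.submatrix (Fin.cons (e d) f : Fin (j + 1) → m) (Fin.cons (e c) g)).det := by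
      rw [det_succ_row_zero, det_succ_row_zero (A.submatrix (Fin.cons (e d) f) _),
        Fin.sum_univ_succ, Fin.sum_univ_succ]
      have h (a : Fin j) : A (e c) (g a) = A (e d) (g a) :=
        off c d _ (hg a c (Finset.mem_insert_self _ _)) (hgd a)
      have hs (p : m) : ((A.submatrix (Fin.cons p f : Fin (j + 1) → m)
          (Fin.cons (e c) g : Fin (j + 1) → m)).submatrix Fin.succ (Fin.succAbove 0)) =
            A.submatrix f g := by
        ext a b
        simp
      have ht (p : m) (t : Fin j → Fin (j + 1)) :
          ((A.submatrix (Fin.cons p f : Fin (j + 1) → m)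
          (Fin.cons (e c) g : Fin (j + 1) → m)).submatrix Fin.succ t) =
            A.submatrix f ((Fin.cons (e c) g : Fin (j + 1) → m) ∘ t) := by
        ext a b
        simp
      simp only [hs, ht, submatrix_apply, Fin.cons_zero, Fin.cons_succ, h, diag c d hdc]
      simp only [Fin.val_zero, pow_zero, one_mul]
      ring
    rw [Finset.prod_insert hc, mul_right_comm, mul_comm, key, mul_sub,
      Finset.card_insert_of_notMem hc, show j + (C.card + 1) = j + 1 + C.card by omega]
    have hg' (a : Fin (j + 1)) : ∀ c' ∈ C, (Fin.cons (e c) g : Fin (j + 1) → m) a ≠ e c' := by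
      intro c' hc'
      refine Fin.cases ?_ (fun a => ?_) a
      · exact fun h => hc (he h ▸ hc')
      · exact hg a c' (Finset.mem_insert_of_mem hc')
    have hgd' (a : Fin (j + 1)) : (Fin.cons (e c) g : Fin (j + 1) → m) a ≠ e d := by
      refine Fin.cases ?_ (fun a => ?_) a
      · exact fun h => hdc (he h)
      · exact hgd a
    exact Ideal.sub_mem _ (ih hdC _ _ hg' hgd') (ih hdC _ _ hg' hgd')

end Matrix

/-! ### Critical ideals and evaluated Laplacians -/

namespace SignedMultidigraph

open Matrix

theorem original_eq_of_ne {V : Type*} {v : V} {K : ℕ} {p q : V ⊕ Fin K} (hpq : p ≠ q)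
    (h : original v K p = original v K q) : original v K p = v := by
  rcases p with u | a <;> rcases q with w | b <;> simp_all [original]

theorem copy_injective {V : Type*} (v : V) (K : ℕ) : Function.Injective (copy v K) := by
  intro c d
  refine Fin.cases ?_ (fun c => ?_) c <;> refine Fin.cases ?_ (fun d => ?_) d <;> simp [copy]

theorem original_copy {V : Type*} (v : V) (K : ℕ) (c : Fin (K + 1)) :
    original v K (copy v K c) = v := by
  refine Fin.cases ?_ (fun c => ?_) c <;> simp [copy, original]

variable {P V S : Type*} [CommRing P] [DecidableEq V] [CommRing S] [Algebra P S]

theorem criticalIdeal_eq_minorIdeal (G : SignedMultidigraph V) (j : ℕ) :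
    G.criticalIdeal P j = (genLaplacian P G).minorIdeal j :=
  (minorIdeal_eq_span_embedding _ _).symm

theorem criticalIdeal_coRank [Nontrivial P] [Fintype V] (G : SignedMultidigraph V) :
    G.criticalIdeal P (G.coRank P) = ⊤ ∧
      ∀ j, G.criticalIdeal P j = ⊤ → j ≤ G.coRank P := by
  have hb : BddAbove {j : ℕ | criticalIdeal P G j = ⊤} := by
    refine ⟨Fintype.card V, fun j hj => ?_⟩
    by_contra hlt
    have hlt : Fintype.card V < j := not_le.1 hlt
    have : criticalIdeal P G j = ⊥ := by
      rw [criticalIdeal, Ideal.span_eq_bot]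
      rintro _ ⟨f, -, -⟩
      have := Fintype.card_le_of_embedding f
      simp only [Fintype.card_fin] at this
      omega
    exact bot_ne_top (this.symm.trans hj)
  have hn : {j : ℕ | criticalIdeal P G j = ⊤}.Nonempty := by
    refine ⟨0, ?_⟩
    rw [Set.mem_ofPred_eq, criticalIdeal_eq_minorIdeal, Ideal.eq_top_iff_one]
    simpa using det_submatrix_mem_minorIdeal (genLaplacian P G) Fin.elim0 Fin.elim0
  exact ⟨Nat.sSup_mem hn hb, fun j hj => le_csSup hb hj⟩

/-- The generalized Laplacian matrix evaluated at `z`. -/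
noncomputable def evalLaplacian (P : Type*) [CommRing P] [Algebra P S] (G : SignedMultidigraph V)
    (z : V → S) : Matrix V V S :=
  (genLaplacian P G).map (aeval z : MvPolynomial V P →ₐ[P] S).toRingHom

theorem evalLaplacian_apply (G : SignedMultidigraph V) (z : V → S) (u w : V) :
    evalLaplacian P G z u w = if u = w then z u
      else algebraMap P S (-(((G.sign u w : ℤ) : P) * (G.mult u w : P))) := by
  simp only [evalLaplacian, genLaplacian, map_apply]
  split_ifs <;> simp

theorem evalLaplacian_X (G : SignedMultidigraph V) :
    evalLaplacian P G (X : V → MvPolynomial V P) = genLaplacian P G := by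
  ext1 u w
  rw [evalLaplacian_apply]
  rfl

theorem evalLaplacian_deleteVertex (G : SignedMultidigraph V) (v : V) (z : V → S) :
    evalLaplacian P (G.deleteVertex v) (fun u => z u) =
      (evalLaplacian P G z).submatrix Subtype.val Subtype.val := by
  ext u w
  simp [evalLaplacian_apply, deleteVertex, Subtype.ext_iff]

theorem evalLaplacian_replicate_apply (G : SignedMultidigraph V) (v : V) (K : ℕ)
    (z : V → S) (hz : z v = -1) (x : V ⊕ Fin K → S) (p q : V ⊕ Fin K) :
    evalLaplacian P (G.replicate v K) x p q = if p = q then x p else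
      evalLaplacian P G z (original v K p) (original v K q) := by
  rw [evalLaplacian_apply, evalLaplacian_apply]
  by_cases hpq : p = q
  · simp [hpq]
  by_cases h : original v K p = original v K q
  · have hv := original_eq_of_ne hpq h
    simp [hpq, ← h, hv, hz, replicate]
  · simp [hpq, h, replicate]

/-- At `x_{v^c} = -1` the diagonal entry of a copy equals its entries towards the other copies, so
all copies have identical rows and columns. -/
theorem evalLaplacian_replicate_original (G : SignedMultidigraph V) (v : V) (K : ℕ)
    (z : V → S) (hz : z v = -1) :
    evalLaplacian P (G.replicate v K) (fun p => z (original v K p)) =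
      (evalLaplacian P G z).submatrix (original v K) (original v K) := by
  ext p q
  rw [evalLaplacian_replicate_apply G v K z hz, submatrix_apply]
  split_ifs with h
  · subst h
    simp [evalLaplacian_apply]
  · rfl

theorem minorIdeal_evalLaplacian_eq_top {G : SignedMultidigraph V} {j : ℕ}
    (h : G.criticalIdeal P j = ⊤) (z : V → S) : (evalLaplacian P G z).minorIdeal j = ⊤ :=
  minorIdeal_map_eq_top _ (by rw [← criticalIdeal_eq_minorIdeal, h])

theorem minorIdeal_evalLaplacian_eq_top_of_replicate {G : SignedMultidigraph V} {v : V} {K j : ℕ}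
    (h : (G.replicate v K).criticalIdeal P j = ⊤) (z : V → S) (hz : z v = -1) :
    (evalLaplacian P G z).minorIdeal j = ⊤ := by
  refine top_le_iff.1 (le_trans ?_ (minorIdeal_submatrix_le _ (original v K) (original v K) j))
  rw [← evalLaplacian_replicate_original G v K z hz, minorIdeal_evalLaplacian_eq_top h]

/-! ### Comparison of the co-ranks of `G - v` and its replications -/

theorem coRank_deleteVertex_le_replicate [Nontrivial P] [Fintype V] (G : SignedMultidigraph V)
    (v : V) (K : ℕ) : (G.deleteVertex v).coRank P ≤ (G.replicate v K).coRank P := by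
  refine (criticalIdeal_coRank _).2 _ (top_le_iff.1 ?_)
  let x : {u // u ≠ v} → MvPolynomial (V ⊕ Fin K) P := fun u => X (Sum.inl u)
  rw [← minorIdeal_evalLaplacian_eq_top (criticalIdeal_coRank (P := P) (G.deleteVertex v)).1 x,
    criticalIdeal_eq_minorIdeal]
  have : evalLaplacian P (G.deleteVertex v) x = (genLaplacian P (G.replicate v K)).submatrix
      (fun u => Sum.inl u.1) (fun u => Sum.inl u.1) := by
    ext1 u w
    rw [← evalLaplacian_X, submatrix_apply, evalLaplacian_apply, evalLaplacian_apply]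
    by_cases h : u = w
    · simp [h, x]
    · have h' : u.1 ≠ w.1 := fun h' => h (Subtype.ext h')
      simp [h, h', replicate, original, deleteVertex]
  rw [this]
  exact minorIdeal_submatrix_le _ _ _ _

theorem coRank_replicate_le_deleteVertex_add_two [Nontrivial P] [Fintype V]
    (G : SignedMultidigraph V) (v : V) (K : ℕ) :
    (G.replicate v K).coRank P ≤ (G.deleteVertex v).coRank P + 2 := by
  obtain hlt | ⟨j, hj⟩ : (G.replicate v K).coRank P < 2 ∨
      ∃ j, (G.replicate v K).coRank P = j + 2 := by
    rcases lt_or_ge ((G.replicate v K).coRank P) 2 with h | h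
    · exact Or.inl h
    · exact Or.inr ⟨_, (Nat.sub_add_cancel h).symm⟩
  · omega
  rw [hj, Nat.add_le_add_iff_right]
  refine (criticalIdeal_coRank _).2 _ (top_le_iff.1 ?_)
  -- Setting every copy of `v` to `-1` collapses the replicated matrix to that of `G`; deleting row
  -- and column `v` then costs at most two.
  let z : V → MvPolynomial {u // u ≠ v} P := fun u => if h : u ≠ v then X ⟨u, h⟩ else -1
  have hz : z v = -1 := by simp [z]
  rw [← minorIdeal_evalLaplacian_eq_top_of_replicate (hj ▸ (criticalIdeal_coRank
    (P := P) (G.replicate v K)).1) z hz, criticalIdeal_eq_minorIdeal, ← evalLaplacian_X,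
    show (X : _ → MvPolynomial {u // u ≠ v} P) = fun u => z u.1 by ext1 u; simp [z, u.2],
    evalLaplacian_deleteVertex]
  exact minorIdeal_add_two_le_delete _ _ _

/-! ### Splitting off the diagonal factors at the copies -/

/-- The variables of `G` inside the polynomial ring of `r^K(G, v)`, with `x_v` replaced by `-1`. -/
noncomputable def replicaPoint (P : Type*) [CommRing P] (v : V) (K : ℕ) :
    V → MvPolynomial (V ⊕ Fin K) P :=
  fun u => rename Sum.inl (Function.update X v (C (-1)) u : MvPolynomial V P)

theorem replicaPoint_self (v : V) (K : ℕ) : replicaPoint P v K v = -1 := by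
  simp [replicaPoint]

theorem replicaPoint_of_ne {v u : V} (h : u ≠ v) (K : ℕ) :
    replicaPoint P v K u = X (Sum.inl u) := by
  simp [replicaPoint, h]

theorem evalCriticalIdeal_eq_minorIdeal (G : SignedMultidigraph V) (v : V) (K j : ℕ) :
    G.evalCriticalIdeal P v K j = (evalLaplacian P G (replicaPoint P v K)).minorIdeal j := by
  rw [evalCriticalIdeal, criticalIdeal_eq_minorIdeal]
  have h1 := map_minorIdeal (genLaplacian P G) (evalVar v (-1 : P)).toRingHom j
  have h2 := map_minorIdeal ((genLaplacian P G).map (evalVar v (-1 : P)).toRingHom)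
    (rename (Sum.inl : V → V ⊕ Fin K) : MvPolynomial V P →ₐ[P] _).toRingHom j
  refine (congrArg _ h1).trans (h2.trans ?_)
  congr 1
  ext1 u w
  rw [evalLaplacian_apply]
  simp only [map_apply, genLaplacian, evalVar, replicaPoint]
  split_ifs <;> simp

theorem eq_copy_or (v : V) (K : ℕ) (p : V ⊕ Fin K) :
    (∃ c, p = copy v K c) ∨ ∃ u, u ≠ v ∧ p = Sum.inl u := by
  rcases p with u | a
  · by_cases h : u = v
    · exact Or.inl ⟨0, by simp [copy, h]⟩
    · exact Or.inr ⟨u, h, rfl⟩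
  · exact Or.inl ⟨a.succ, by simp [copy]⟩

/-- The factor `x_{v^c} + 1`. -/
noncomputable def replicaFactor (P : Type*) [CommRing P] (v : V) (K : ℕ) (c : Fin (K + 1)) :
    MvPolynomial (V ⊕ Fin K) P :=
  X (copy v K c) + 1

theorem genLaplacian_replicate (G : SignedMultidigraph V) (v : V) (K : ℕ) :
    genLaplacian P (G.replicate v K) =
      (evalLaplacian P G (replicaPoint P v K)).submatrix (original v K) (original v K) +
        ∑ c, single (copy v K c) (copy v K c) (replicaFactor P v K c) := by
  ext1 p q
  rw [← evalLaplacian_X, evalLaplacian_replicate_apply G v K _ (replicaPoint_self v K),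
    Matrix.add_apply, Matrix.sum_apply]
  simp only [single_apply, submatrix_apply]
  by_cases hpq : p = q
  · subst hpq
    rw [if_pos rfl, evalLaplacian_apply, if_pos rfl]
    rcases eq_copy_or v K p with ⟨c, rfl⟩ | ⟨u, hu, rfl⟩
    · simp [original_copy, replicaPoint_self, (copy_injective v K).eq_iff, replicaFactor]
    · have h (c : Fin (K + 1)) : copy v K c ≠ Sum.inl u := fun h => hu (by
        rw [← original_copy v K c, h]; rfl)
      simp [h, original, replicaPoint_of_ne hu]
  · have h (c : Fin (K + 1)) : ¬ (copy v K c = p ∧ copy v K c = q) :=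
      fun h => hpq (h.1.symm.trans h.2)
    simp [hpq, h]

/-! ### Products of factors times minors lie in the critical ideal -/

/-- By `hfg` no diagonal entry of a copy is selected, so the minor is the same for the true
Laplacian and for the duplicated matrix, and bordering applies. -/
theorem prod_replicaFactor_mul_minor_mem (G : SignedMultidigraph V) (v : V) (K : ℕ)
    (d : Fin (K + 1)) (C : Finset (Fin (K + 1))) (hd : d ∉ C) {j : ℕ}
    (f g : Fin j → V ⊕ Fin K) (hg : ∀ a, ∀ c ∈ C, g a ≠ copy v K c)
    (hgd : ∀ a, g a ≠ copy v K d) (hfg : ∀ a b c, f a = copy v K c → g b ≠ copy v K c) :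
    (∏ c ∈ C, replicaFactor P v K c) * ((evalLaplacian P G (replicaPoint P v K)).submatrix
        (original v K ∘ f) (original v K ∘ g)).det ∈
      (G.replicate v K).criticalIdeal P (j + C.card) := by
  have hL (p q) : genLaplacian P (G.replicate v K) p q = if p = q then X p else
      evalLaplacian P G (replicaPoint P v K) (original v K p) (original v K q) := by
    rw [← evalLaplacian_X, evalLaplacian_replicate_apply G v K _ (replicaPoint_self v K)]
  have hM : (genLaplacian P (G.replicate v K)).submatrix f g =
      (evalLaplacian P G (replicaPoint P v K)).submatrix
        (original v K ∘ f) (original v K ∘ g) := by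
    ext1 a b
    rw [genLaplacian_replicate, submatrix_apply, Matrix.add_apply, Matrix.sum_apply,
      Finset.sum_eq_zero, add_zero]
    · rfl
    · intro c _
      rw [single_apply, if_neg]
      exact fun h => hfg a b c h.1.symm h.2.symm
  rw [← hM, criticalIdeal_eq_minorIdeal]
  refine prod_mul_det_submatrix_mem _ (copy v K) _ (copy_injective v K) ?_ ?_ d C hd f g hg hgd
  · intro c d q hc hd
    rw [hL, hL, if_neg hc.symm, if_neg hd.symm, original_copy, original_copy]
  · intro c d hcd
    rw [hL, hL, if_pos rfl, if_neg fun h => hcd (copy_injective v K h).symm, original_copy,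
      original_copy, evalLaplacian_apply, if_pos rfl, replicaPoint_self, replicaFactor]
    ring

theorem prod_replicaFactor_mul_mem (G : SignedMultidigraph V) (v : V) (K j : ℕ)
    (C : Finset (Fin (K + 1))) (hC : C.card < K) (b : MvPolynomial (V ⊕ Fin K) P)
    (hb : b ∈ (evalLaplacian P G (replicaPoint P v K)).minorIdeal j) :
    (∏ c ∈ C, replicaFactor P v K c) * b ∈
      (G.replicate v K).criticalIdeal P (j + C.card) := by
  obtain ⟨d, hd, d', hd', hne⟩ := Finset.one_lt_card.1
    (show 1 < Cᶜ.card by rw [Finset.card_compl, Fintype.card_fin]; omega)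
  rw [Finset.mem_compl] at hd hd'
  -- Row `v` is lifted to `d` and column `v` to `d'`, so the entry `-1` at `(v, v)` becomes an arc
  -- between distinct copies. Column `d` stays free, so `d` is also the spare row for bordering.
  let lift (d : Fin (K + 1)) (u : V) : V ⊕ Fin K := if u = v then copy v K d else Sum.inl u
  have hlift (d u) : original v K (lift d u) = u := by
    by_cases h : u = v
    · simp [lift, h, original_copy]
    · simp [lift, h, original]
  have hcopy (d u c) (h : lift d u = copy v K c) : d = c := by
    have hu : u = v := by rw [← hlift d u, h, original_copy]
    simp only [lift, hu, if_true] at h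
    exact copy_injective v K h
  have hle : (evalLaplacian P G (replicaPoint P v K)).minorIdeal j ≤
      Submodule.comap (LinearMap.mulLeft _ (∏ c ∈ C, replicaFactor P v K c))
        ((G.replicate v K).criticalIdeal P (j + C.card)) := by
    refine minorIdeal_le_iff.2 fun f g => ?_
    have := prod_replicaFactor_mul_minor_mem (P := P) G v K d C hd (fun a => lift d (f a))
      (fun a => lift d' (g a)) (fun a c hc h => hd' (hcopy _ _ _ h ▸ hc))
      (fun a h => hne (hcopy _ _ _ h).symm)
      (fun a b c h h' => hne ((hcopy _ _ _ h).trans (hcopy _ _ _ h').symm))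
    simp only [Function.comp_def, hlift] at this
    exact this
  exact hle hb

theorem prod_replicaFactor_mem (G : SignedMultidigraph V) (v : V) (K j : ℕ)
    (C : Finset (Fin (K + 1))) (hC : C.card ≤ K)
    (htop : (G.deleteVertex v).criticalIdeal P j = ⊤) :
    (∏ c ∈ C, replicaFactor P v K c) ∈ (G.replicate v K).criticalIdeal P (j + C.card) := by
  obtain ⟨d, hd⟩ := Finset.card_pos.1
    (show 0 < Cᶜ.card by rw [Finset.card_compl, Fintype.card_fin]; omega)
  rw [Finset.mem_compl] at hd
  have hne (u : {u // u ≠ v}) (c : Fin (K + 1)) : Sum.inl u.1 ≠ copy v K c := fun h =>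
    u.2 ((congrArg (original v K) h).trans (original_copy v K c))
  have hle : (evalLaplacian P (G.deleteVertex v) fun u => replicaPoint P v K u).minorIdeal j ≤
      Submodule.comap (LinearMap.mulLeft _ (∏ c ∈ C, replicaFactor P v K c))
        ((G.replicate v K).criticalIdeal P (j + C.card)) := by
    refine minorIdeal_le_iff.2 fun f g => ?_
    rw [evalLaplacian_deleteVertex]
    exact prod_replicaFactor_mul_minor_mem (P := P) G v K d C hd (fun a => Sum.inl (f a))
      (fun a => Sum.inl (g a)) (fun a c _ => hne _ c) (fun a => hne _ d) (fun a b c _ => hne _ c)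
  rw [minorIdeal_evalLaplacian_eq_top htop] at hle
  simpa using hle (Submodule.mem_top (x := 1))

end SignedMultidigraph

open SignedMultidigraph Matrix

-- The roles of the constants: `γ_r` makes the ideal of `γ_r`-minors of `M` trivial, and `lam`
-- supplies the second spare copy when `γ_v ≠ γ_r`.
theorem mainTheorem4 {P : Type*} [CommRing P] [IsDomain P] [IsPrincipalIdealRing P]
    {V : Type*} [Fintype V] [DecidableEq V] (G : SignedMultidigraph V) (v : V)
    (γ_r γ_v lam : ℕ)
    (hγ_r : γ_r = (G.replicate v 1).coRank P)
    (hγ_v : γ_v = (G.deleteVertex v).coRank P)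
    (hlam : lam = SignedMultidigraph.lam γ_v γ_r)
    (hγ : 2 ≤ G.coRank P) :
    (0 ≤ (γ_r : ℤ) - (γ_v : ℤ) ∧ (γ_r : ℤ) - (γ_v : ℤ) ≤ 2) ∧
    ∀ k i : ℕ, 1 ≤ k →
      (G.replicate v (k + lam + i)).criticalIdeal P (γ_r + k) =
        Ideal.span (⋃ l ∈ Finset.range (k + 1),
          SignedMultidigraph.replicaProducts P v (k + lam + i) l *
            (G.evalCriticalIdeal P v (k + lam + i) (γ_r + k - l) :
              Set (MvPolynomial (V ⊕ Fin (k + lam + i)) P))) := by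
  subst hγ_r hγ_v hlam
  have hle := coRank_deleteVertex_le_replicate (P := P) G v 1
  have hle2 := coRank_replicate_le_deleteVertex_add_two (P := P) G v 1
  refine ⟨⟨by omega, by omega⟩, fun k i hk => ?_⟩
  set γ := (G.replicate v 1).coRank P with hγr
  set K := k + SignedMultidigraph.lam ((G.deleteVertex v).coRank P) γ + i with hK
  have htop : (evalLaplacian P G (replicaPoint P v K)).minorIdeal γ = ⊤ :=
    minorIdeal_evalLaplacian_eq_top_of_replicate (criticalIdeal_coRank (P := P) _).1 _
      (replicaPoint_self v K)
  apply le_antisymm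
  · rw [criticalIdeal_eq_minorIdeal, minorIdeal_le_iff]
    intro f g
    rw [genLaplacian_replicate]
    refine (Ideal.span_le.2 ?_) (det_submatrix_add_sum_single_mem _ _ _ _ f g)
    rintro _ ⟨C, -, l, hl, b, hb, rfl⟩
    rcases le_or_gt C.card k with hC | hC
    · refine Ideal.subset_span (Set.mem_biUnion (x := C.card)
        (Finset.mem_coe.2 (Finset.mem_range.2 (by omega))) ?_)
      refine Set.mul_mem_mul ⟨C, rfl, rfl⟩ ?_
      rw [show γ + k - C.card = l by omega, SetLike.mem_coe, evalCriticalIdeal_eq_minorIdeal]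
      exact minorIdeal_submatrix_le _ _ _ _ hb
    -- Only `k` factors are kept; the rest is a multiplier, and the product of the kept ones is a
    -- generator for `l = k`.
    · obtain ⟨C', hC', hcard⟩ := Finset.exists_subset_card_eq hC.le
      rw [← Finset.prod_sdiff hC', mul_comm (∏ c ∈ C \ C', _), mul_assoc, SetLike.mem_coe]
      refine Ideal.mul_mem_right _ _ (Ideal.subset_span (Set.mem_biUnion (x := k)
        (Finset.mem_coe.2 (Finset.mem_range.2 (by omega))) ?_))
      rw [← mul_one (∏ c ∈ C', _)]
      refine Set.mul_mem_mul ⟨C', hcard, rfl⟩ ?_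
      rw [show γ + k - k = γ by omega, SetLike.mem_coe, evalCriticalIdeal_eq_minorIdeal, htop]
      exact Submodule.mem_top
  · rw [Ideal.span_le]
    simp only [Set.iUnion_subset_iff]
    intro l hl
    rw [Finset.mem_range] at hl
    rintro _ ⟨_, ⟨C, rfl, rfl⟩, b, hb, rfl⟩
    rw [SetLike.mem_coe, evalCriticalIdeal_eq_minorIdeal] at hb
    rcases Nat.lt_or_ge C.card K with hC | hC
    · have := prod_replicaFactor_mul_mem G v K _ C hC b hb
      rwa [show γ + k - C.card + C.card = γ + k by omega] at this
    -- Here `K ≤ C.card ≤ k` forces `lam = 0` and `i = 0`, so the `γ`-minors of `G - v` generate the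
    -- unit ideal.
    · have hγ' : (G.deleteVertex v).coRank P = γ := by
        by_contra hne
        simp only [SignedMultidigraph.lam, if_neg hne] at hK
        omega
      have hCk : C.card = k := by omega
      have hCK : C.card ≤ K := by omega
      have := prod_replicaFactor_mem G v K γ C hCK (hγ' ▸ (criticalIdeal_coRank (P := P) _).1)
      rw [hCk] at this
      exact Ideal.mul_mem_right _ _ this
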